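/- **Bézout's Theorem.** Let $K$ be a field with algebraic closure $\overline K$, and let $A,B\in K[x,y,z]$ be homogeneous polynomials of degrees $m$ and $n$ respectively, with no nonconstant common factor in $K[x,y,z]$. For a point $\mathbf P$ of the projective plane $\overline K\mathbb P^2$ let $$R_{\mathbf P}=\left\{\frac ST : S,T\in\overline K[x,y,z]\text{ homogeneous of the same degree},\ T(\mathbf P)\neq 0\right\}\subset \overline K(x,y,z),$$ let $(A,B)_{\mathbf P}$ be the ideal of $R_{\mathbf P}$ consisting of those $S/T\in R_{\mathbf P}$ (with $S,T$ as above) such that $S=MA+NB$ for some $M,N\in\overline K[x,y,z]$, and define the intersection multiplicity of $A$ and $B$ at $\mathbf P$ by $$i_{\mathbf P}(A,B)=\dim_{\overline K} R_{\mathbf P}/(A,B)_{\mathbf P}.$$ Then the curves $A=0$ and $B=0$ have only finitely many common points in $\overline K\mathbb P^2$; for every $\mathbf P\in\overline K\mathbb P^2$ the multiplicity $i_{\mathbf P}(A,B)$ is finite, and it is positive if and only if $\mathbf P$ lies on both curves; and the curves intersect in exactly $mn$ points of $\overline K\mathbb P^2$, counted with multiplicity: $$\sum_{\mathbf P:\ A(\mathbf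 P)=B(\mathbf P)=0} i_{\mathbf P}(A,B)=mn .$$ -/

import Mathlib

open MvPolynomial
open scoped LinearAlgebra.Projectivization

namespace PlaneCurve

variable {L : Type*} [Field L]

/-- The projective plane over `L`: nonzero vectors of `L³` up to nonzero scalars. -/
abbrev Plane (L : Type*) [Field L] : Type _ := ℙ L (Fin 3 → L)

/-- The polynomial `F` vanishes at the (chosen representative of the) point `P`. It is only used for
homogeneous `F`, for which the choice is immaterial, see `vanishesAt_mk_iff`. -/
def VanishesAt (F : MvPolynomial (Fin 3) L) (P : Plane L) : Prop :=
  eval P.rep F = 0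

theorem vanishesAt_mk_iff {F : MvPolynomial (Fin 3) L} {d : ℕ} (hF : F.IsHomogeneous d)
    (v : Fin 3 → L) (hv : v ≠ 0) :
    VanishesAt F (Projectivization.mk L v hv) ↔ eval v F = 0 := by
  obtain ⟨a, ha⟩ := Projectivization.exists_smul_eq_mk_rep L v hv
  have h : eval ((a : L) • v) F = (a : L) ^ d * eval v F := by
    rw [eval_eq', eval_eq', Finset.mul_sum]
    refine Finset.sum_congr rfl fun e he => ?_
    have hd : ∑ i, e i = d := by
      have := hF (mem_support_iff.mp he)
      rwa [Finsupp.weight_apply, Finsupp.sum_fintype _ _ (by simp), Finset.sum_congr rfl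
        (fun i _ => by simp : ∀ i ∈ Finset.univ, e i • (1 : Fin 3 → ℕ) i = e i)] at this
    simp only [Pi.smul_apply, smul_eq_mul, mul_pow, Finset.prod_mul_distrib]
    rw [Finset.prod_pow_eq_pow_sum, hd]
    ring
  unfold VanishesAt
  rw [← ha]
  change eval ((a : L) • v) F = 0 ↔ _
  rw [h]
  simp

/-- The points of the projective plane that lie on both curves `A = 0` and `B = 0`. -/
def commonPoints (A B : MvPolynomial (Fin 3) L) : Set (Plane L) :=
  {P | VanishesAt A P ∧ VanishesAt B P}

/-- The rational function `S / T`, an element of `L(x, y, z)`. -/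
noncomputable def frac (S T : MvPolynomial (Fin 3) L) :
    FractionRing (MvPolynomial (Fin 3) L) :=
  algebraMap (MvPolynomial (Fin 3) L) (FractionRing (MvPolynomial (Fin 3) L)) S /
    algebraMap (MvPolynomial (Fin 3) L) (FractionRing (MvPolynomial (Fin 3) L)) T

theorem ne_zero_of_not_vanishesAt {T : MvPolynomial (Fin 3) L} {P : Plane L}
    (h : ¬ VanishesAt T P) :
    algebraMap (MvPolynomial (Fin 3) L) (FractionRing (MvPolynomial (Fin 3) L)) T ≠ 0 := by
  intro h0
  have : T = 0 := by
    apply IsFractionRing.injective (MvPolynomial (Fin 3) L)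
      (FractionRing (MvPolynomial (Fin 3) L))
    rw [h0, map_zero]
  exact h (by simp [VanishesAt, this])

theorem not_vanishesAt_mul {S T : MvPolynomial (Fin 3) L} {P : Plane L}
    (hS : ¬ VanishesAt S P) (hT : ¬ VanishesAt T P) : ¬ VanishesAt (S * T) P := by
  simp only [VanishesAt, map_mul] at *
  exact mul_ne_zero hS hT

theorem not_vanishesAt_one (P : Plane L) :
    ¬ VanishesAt (1 : MvPolynomial (Fin 3) L) P := by
  simp [VanishesAt]

theorem frac_mul_frac (S T S' T' : MvPolynomial (Fin 3) L) :
    frac S T * frac S' T' = frac (S * S') (T * T') := by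
  simp only [frac, map_mul]
  exact div_mul_div_comm _ _ _ _

theorem frac_add_frac {S T S' T' : MvPolynomial (Fin 3) L} {P : Plane L}
    (hT : ¬ VanishesAt T P) (hT' : ¬ VanishesAt T' P) :
    frac S T + frac S' T' = frac (S * T' + T * S') (T * T') := by
  simp only [frac, map_mul, map_add]
  exact div_add_div _ _ (ne_zero_of_not_vanishesAt hT) (ne_zero_of_not_vanishesAt hT')

/-- The local ring `R_P` of rational functions of degree `0` at `P`: all quotients `S / T` of
homogeneous polynomials of the same degree with `T(P) ≠ 0`, inside `L(x, y, z)`. -/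
noncomputable def localRing (P : Plane L) :
    Subalgebra L (FractionRing (MvPolynomial (Fin 3) L)) where
  carrier := {q | ∃ (d : ℕ) (S T : MvPolynomial (Fin 3) L),
    S.IsHomogeneous d ∧ T.IsHomogeneous d ∧ ¬ VanishesAt T P ∧ q = frac S T}
  mul_mem' := by
    rintro _ _ ⟨d, S, T, hS, hT, hP, rfl⟩ ⟨d', S', T', hS', hT', hP', rfl⟩
    exact ⟨d + d', S * S', T * T', hS.mul hS', hT.mul hT', not_vanishesAt_mul hP hP',
      frac_mul_frac S T S' T'⟩
  add_mem' := by
    rintro _ _ ⟨d, S, T, hS, hT, hP, rfl⟩ ⟨d', S', T', hS', hT', hP', rfl⟩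
    exact ⟨d + d', S * T' + T * S', T * T', (hS.mul hT').add (hT.mul hS'), hT.mul hT',
      not_vanishesAt_mul hP hP', frac_add_frac hP hP'⟩
  algebraMap_mem' c := by
    refine ⟨0, C c, 1, isHomogeneous_C _ c, isHomogeneous_one _ _, not_vanishesAt_one P, ?_⟩
    simp only [frac, map_one, div_one]
    rw [IsScalarTower.algebraMap_apply L (MvPolynomial (Fin 3) L)
      (FractionRing (MvPolynomial (Fin 3) L)), MvPolynomial.algebraMap_eq]

/-- The ideal `(A, B)_P` of `R_P`: the elements `S / T` of `R_P` (with `S`, `T` homogeneous of the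
same degree and `T(P) ≠ 0`) whose numerator has the form `S = M A + N B`. -/
noncomputable def localIdeal (A B : MvPolynomial (Fin 3) L) (P : Plane L) :
    Ideal (localRing P) where
  carrier := {q | ∃ (d : ℕ) (M N T : MvPolynomial (Fin 3) L),
    (M * A + N * B).IsHomogeneous d ∧ T.IsHomogeneous d ∧ ¬ VanishesAt T P ∧
      (q : FractionRing (MvPolynomial (Fin 3) L)) = frac (M * A + N * B) T}
  zero_mem' :=
    ⟨0, 0, 0, 1, by simpa using isHomogeneous_zero _ _ _, isHomogeneous_one _ _,
      not_vanishesAt_one P, by simp [frac]⟩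
  add_mem' := by
    rintro q q' ⟨d, M, N, T, hS, hT, hP, h⟩ ⟨d', M', N', T', hS', hT', hP', h'⟩
    have e : (M * T' + T * M') * A + (N * T' + T * N') * B =
        (M * A + N * B) * T' + T * (M' * A + N' * B) := by ring
    refine ⟨d + d', M * T' + T * M', N * T' + T * N', T * T', ?_, hT.mul hT',
      not_vanishesAt_mul hP hP', ?_⟩
    · rw [e]
      exact (hS.mul hT').add (hT.mul hS')
    · rw [e, ← frac_add_frac hP hP', ← h, ← h']
      rfl
  smul_mem' := by
    rintro ⟨_, d', S', T', hS', hT', hP', rfl⟩ q ⟨d, M, N, T, hS, hT, hP, h⟩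
    have e : (S' * M) * A + (S' * N) * B = S' * (M * A + N * B) := by ring
    refine ⟨d' + d, S' * M, S' * N, T' * T, ?_, hT'.mul hT, not_vanishesAt_mul hP' hP, ?_⟩
    · rw [e]
      exact hS'.mul hS
    · rw [e, ← frac_mul_frac, ← h]
      rfl

/-- The intersection multiplicity `i_P(A, B)`, the dimension of the `L`-vector space
`R_P / (A, B)_P`. (`Module.finrank` is `0` on infinite-dimensional spaces, so finiteness of the
dimension has to be asserted alongside.) -/
noncomputable def intersectionMultiplicity (A B : MvPolynomial (Fin 3) L) (P : Plane L) : ℕ :=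
  Module.finrank L (localRing P ⧸ localIdeal A B P)

end PlaneCurve

namespace PlaneCurve

/-! ### Graded pieces of polynomial rings and extension of the base field -/

section Algebra

/-! The number `m * n` is the eventual value of the Hilbert function of `S / (A, B)`, where `S =
L[x, y, z]`. Coprimality over `K` makes `B` a nonzerodivisor modulo `A`, and this survives the
passage to `L` because `L[x, y, z]` is free over `K[x, y, z]` (`dvd_of_dvd_mul_map`). The Koszul
relations then give dimension `m * n` in every degree `d ≥ m + n` (`finrank_map_mkQ_span_pair`).

For a linear form `ℓ`, the chart ring `S / (A, B, ℓ - 1)` is exhausted by images of these graded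
pieces, so its dimension is at most `m * n`. Distinct common points off `ℓ = 0` give distinct
evaluations on it, which bounds their number. Now let `ℓ` avoid all common points. By the
Nullstellensatz, multiplication by `ℓ` is surjective between the graded pieces of large degree;
equal dimensions make it injective, and the chart ring has dimension exactly `m * n`
(`finrank_affineRing`).

The chart ring is Artinian, hence the product of its localizations at maximal ideals. These ideals
correspond to the common points, and the localization at `P` is `R_P / (A, B)_P`
(`isLocalization_germ`). Adding dimensions gives the theorem. -/

theorem homogeneousComponent_mul_of_isHomogeneous {σ R : Type*} [CommRing R]
    {A : MvPolynomial σ R} {m : ℕ} (hA : A.IsHomogeneous m) (g : MvPolynomial σ R) (k : ℕ) :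
    homogeneousComponent (k + m) (g * A) = homogeneousComponent k g * A := by
  conv_lhs => rw [← sum_homogeneousComponent g, Finset.sum_mul, map_sum]
  have h : ∀ i, homogeneousComponent (k + m) (homogeneousComponent i g * A) =
      if i = k then homogeneousComponent i g * A else 0 := fun i => by
    rw [homogeneousComponent_of_mem ((homogeneousComponent_isHomogeneous i g).mul hA)]
    simp [eq_comm]
  simp only [h, Finset.sum_ite_eq', Finset.mem_range]
  split_ifs with hk
  · rfl
  · rw [homogeneousComponent_eq_zero _ _ (by omega), zero_mul]

theorem homogeneousComponent_mul_of_isHomogeneous_of_lt {σ R : Type*} [CommRing R]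
    {A : MvPolynomial σ R} {m : ℕ} (hA : A.IsHomogeneous m) (g : MvPolynomial σ R) {k : ℕ}
    (hk : k < m) : homogeneousComponent k (g * A) = 0 := by
  rw [← sum_homogeneousComponent g, Finset.sum_mul, map_sum]
  refine Finset.sum_eq_zero fun i _ => ?_
  rw [homogeneousComponent_of_mem ((homogeneousComponent_isHomogeneous i g).mul hA),
    if_neg (by omega)]

instance finite_homogeneousSubmodule {σ R : Type*} [CommRing R] [Finite σ] (d : ℕ) :
    Module.Finite R (homogeneousSubmodule σ R d) :=
  Module.Finite.iff_fg.mpr (homogeneousSubmodule_fg σ R d)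

theorem finrank_homogeneousSubmodule (L : Type*) [Field L] (d : ℕ) :
    Module.finrank L (homogeneousSubmodule (Fin 3) L d) = (d + 2).choose 2 := by
  have e : Module.Basis {x : Fin 3 →₀ ℕ | x.degree = d} L (homogeneousSubmodule (Fin 3) L d) := by
    rw [homogeneousSubmodule_eq_finsupp_supported]
    exact basisRestrictSupport L _
  rw [Module.finrank_eq_nat_card_basis e]
  have : {x : Fin 3 →₀ ℕ | x.degree = d} = ((Finset.univ : Finset (Fin 3)).finsuppAntidiag d) := by
    ext x
    simp [Finsupp.degree_eq_sum]
  rw [this]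
  simp only [SetLike.coe_sort_coe, Nat.card_eq_fintype_card, Fintype.card_coe]
  rw [Finset.card_finsuppAntidiag_nat_eq_choose, Finset.card_univ, Fintype.card_fin,
    show 3 + d - 1 = d + 2 by omega, ← Nat.choose_symm_add]

/-- A vector space basis of an extension field splits a polynomial into its components over the
small field. -/
theorem dvd_of_dvd_mul_map {K L : Type*} [Field K] [Field L] [Algebra K L] {σ : Type*}
    {A B : MvPolynomial σ K} (h : ∀ f, A ∣ B * f → A ∣ f) (f : MvPolynomial σ L)
    (hf : map (algebraMap K L) A ∣ map (algebraMap K L) B * f) :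
    map (algebraMap K L) A ∣ f := by
  let _ : Algebra (MvPolynomial σ K) (MvPolynomial σ L) := algebraMvPolynomial
  -- `L[σ]` is the base change of the free `K`-module `L` to `K[σ]`.
  have hfree : Module.Free (MvPolynomial σ K) (MvPolynomial σ L) :=
    (Algebra.IsPushout.out (R := K) (S := MvPolynomial σ K) (R' := L)
      (S' := MvPolynomial σ L)).free
  have b := Module.Free.chooseBasis (MvPolynomial σ K) (MvPolynomial σ L)
  obtain ⟨g, hg⟩ := hf
  have e : B • f = A • g := by simpa only [Algebra.smul_def, algebraMap_def] using hg
  have hd : ∀ i, A ∣ b.repr f i := fun i => h _ ⟨b.repr g i, by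
    simpa using congrArg (fun x => b.repr x i) e⟩
  rw [← b.linearCombination_repr f, Finsupp.linearCombination_apply]
  refine Finset.dvd_sum fun i _ => ?_
  dsimp only
  rw [Algebra.smul_def, algebraMap_def]
  exact (map_dvd _ (hd i)).mul_right _

theorem isRelPrime_of_forall_dvd_eq_C {K : Type*} [Field K] {σ : Type*} [Nonempty σ]
    {A B : MvPolynomial σ K}
    (hAB : ∀ D : MvPolynomial σ K, D ∣ A → D ∣ B → ∃ c : K, D = C c) : IsRelPrime A B := by
  intro D hA hB
  obtain ⟨c, rfl⟩ := hAB D hA hB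
  -- The hypothesis admits `c = 0`; but then `A = B = 0`, and a variable is a nonconstant common
  -- divisor.
  by_cases hc : c = 0
  · obtain ⟨i⟩ := ‹Nonempty σ›
    subst hc
    simp only [map_zero, zero_dvd_iff] at hA hB
    obtain ⟨c, h⟩ := hAB (X i) (by simp [hA]) (by simp [hB])
    have := congrArg totalDegree h
    simp at this
  · exact (IsUnit.mk0 c hc).map C

theorem finrank_map_mkQ_add_finrank_inf {F V : Type*} [Field F] [AddCommGroup V] [Module F V]
    (U N : Submodule F V) [Module.Finite F U] :
    Module.finrank F (U.map N.mkQ) + Module.finrank F (U ⊓ N : Submodule F V) =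
      Module.finrank F U := by
  have h := LinearMap.finrank_range_add_finrank_ker (N.mkQ.domRestrict U)
  rw [LinearMap.range_domRestrict, LinearMap.ker_domRestrict, Submodule.ker_mkQ] at h
  rw [← h]
  congr 1
  rw [(Submodule.equivSubtypeMap U (N.comap U.subtype)).finrank_eq, Submodule.map_comap_subtype]

end Algebra

variable {L : Type*} [Field L]

/-! ### The Hilbert function from the Koszul complex -/

section HilbertFunction

/-- Dimension count in the exact sequence `0 → S_k → S_(n+k) × S_(m+k) → (A, B)_(m+n+k) → 0`, with
maps `κ : g ↦ (g B, -g A)` and `φ : (a, b) ↦ a A + b B`. Exactness in the middle is the regularity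
of the pair. -/
theorem finrank_inf_span_pair {A B : MvPolynomial (Fin 3) L} {m n : ℕ}
    (hA : A.IsHomogeneous m) (hB : B.IsHomogeneous n) (hA0 : A ≠ 0)
    (hAB : ∀ f, A ∣ B * f → A ∣ f) (k : ℕ) :
    Module.finrank L (homogeneousSubmodule (Fin 3) L (m + n + k) ⊓
        (Ideal.span {A, B}).restrictScalars L : Submodule L (MvPolynomial (Fin 3) L)) +
      (k + 2).choose 2 = (n + k + 2).choose 2 + (m + k + 2).choose 2 := by
  let φ : (homogeneousSubmodule (Fin 3) L (n + k) × homogeneousSubmodule (Fin 3) L (m + k)) →ₗ[L]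
      MvPolynomial (Fin 3) L :=
    ((LinearMap.mulRight L A).comp (Submodule.subtype _)).coprod
      ((LinearMap.mulRight L B).comp (Submodule.subtype _))
  let κ : homogeneousSubmodule (Fin 3) L k →ₗ[L]
      (homogeneousSubmodule (Fin 3) L (n + k) × homogeneousSubmodule (Fin 3) L (m + k)) :=
    (((LinearMap.mulRight L B).comp (Submodule.subtype _)).codRestrict _ fun g => by
      have := g.2.mul hB
      rwa [add_comm] at this).prod
    (-((LinearMap.mulRight L A).comp (Submodule.subtype _)).codRestrict _ fun g => by
      have := g.2.mul hA
      rwa [add_comm] at this)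
  have hφ : LinearMap.range φ = homogeneousSubmodule (Fin 3) L (m + n + k) ⊓
      (Ideal.span {A, B}).restrictScalars L := by
    ext f
    constructor
    · rintro ⟨⟨a, b⟩, rfl⟩
      refine ⟨?_, Ideal.mem_span_pair.mpr ⟨a, b, rfl⟩⟩
      have ha := a.2.mul hA
      have hb := b.2.mul hB
      rw [show n + k + m = m + n + k by ring] at ha
      rw [show m + k + n = m + n + k by ring] at hb
      exact ha.add hb
    · rintro ⟨hf, hfI⟩
      obtain ⟨a, b, hab⟩ := Ideal.mem_span_pair.mp hfI
      refine ⟨(⟨_, homogeneousComponent_isHomogeneous (n + k) a⟩,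
        ⟨_, homogeneousComponent_isHomogeneous (m + k) b⟩), ?_⟩
      change homogeneousComponent (n + k) a * A + homogeneousComponent (m + k) b * B = f
      rw [← homogeneousComponent_mul_of_isHomogeneous hA,
        ← homogeneousComponent_mul_of_isHomogeneous hB,
        show n + k + m = m + n + k by ring, show m + k + n = m + n + k by ring, ← map_add, hab,
        homogeneousComponent_eq_self hf]
  have hκ : LinearMap.range κ = LinearMap.ker φ := by
    ext ⟨⟨a, ha⟩, ⟨b, hb⟩⟩
    constructor
    · rintro ⟨g, hg⟩
      rw [← hg]
      change (g : MvPolynomial (Fin 3) L) * B * A + -((g : MvPolynomial (Fin 3) L) * A) * B = 0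
      ring
    · intro h
      change a * A + b * B = 0 at h
      obtain ⟨g, rfl⟩ := hAB b ⟨-a, by linear_combination h⟩
      have hg : homogeneousComponent k g * A = A * g := by
        rw [← homogeneousComponent_mul_of_isHomogeneous hA, mul_comm g, add_comm,
          homogeneousComponent_eq_self hb]
      -- The cofactor `g` is a priori inhomogeneous; cancelling `A` shows that it is its own
      -- component of degree `k`.
      have hg' : homogeneousComponent k g = g := mul_right_cancel₀ hA0 (by rw [hg, mul_comm])
      have hgk : g.IsHomogeneous k := hg' ▸ homogeneousComponent_isHomogeneous k g
      have hga : a = -(g * B) := mul_right_cancel₀ hA0 (by linear_combination h)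
      refine ⟨⟨-g, hgk.neg⟩, ?_⟩
      refine Prod.ext (Subtype.ext ?_) (Subtype.ext ?_)
      · change -g * B = a
        rw [hga]; ring
      · change -(-g * A) = A * g
        ring
  have hinj : Function.Injective κ := fun g g' h => by
    have := congrArg (fun x => (x.2 : MvPolynomial (Fin 3) L)) h
    change -((g : MvPolynomial (Fin 3) L) * A) = -((g' : MvPolynomial (Fin 3) L) * A) at this
    exact Subtype.ext (mul_right_cancel₀ hA0 (neg_injective this))
  have h := LinearMap.finrank_range_add_finrank_ker φ
  rwa [← hκ, LinearMap.finrank_range_of_inj hinj, hφ, Module.finrank_prod,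
    finrank_homogeneousSubmodule, finrank_homogeneousSubmodule,
    finrank_homogeneousSubmodule] at h

/-- The Hilbert function of a complete intersection of two plane curves. -/
theorem finrank_map_mkQ_span_pair {A B : MvPolynomial (Fin 3) L} {m n : ℕ}
    (hA : A.IsHomogeneous m) (hB : B.IsHomogeneous n) (hA0 : A ≠ 0)
    (hAB : ∀ f, A ∣ B * f → A ∣ f) {d : ℕ} (hd : m + n ≤ d) :
    Module.finrank L ((homogeneousSubmodule (Fin 3) L d).map
      ((Ideal.span {A, B}).restrictScalars L).mkQ) = m * n := by
  obtain ⟨k, rfl⟩ := Nat.exists_eq_add_of_le hd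
  have h₁ := finrank_map_mkQ_add_finrank_inf (homogeneousSubmodule (Fin 3) L (m + n + k))
    ((Ideal.span {A, B}).restrictScalars L)
  have h₂ := finrank_inf_span_pair hA hB hA0 hAB k
  rw [finrank_homogeneousSubmodule] at h₁
  have h₃ : (m + n + k + 2).choose 2 + (k + 2).choose 2 =
      m * n + ((n + k + 2).choose 2 + (m + k + 2).choose 2) := by
    -- Over `ℚ` the binomial coefficients are polynomials, so the identity is a `ring` computation.
    have : ((m + n + k + 2).choose 2 + (k + 2).choose 2 : ℚ) =
        m * n + ((n + k + 2).choose 2 + (m + k + 2).choose 2) := by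
      simp only [Nat.cast_choose_two]
      push_cast
      ring
    exact_mod_cast this
  omega

end HilbertFunction

/-! ### Homogenization with respect to a linear form -/

section Homogenization

/-- Multiply the components of degree at most `D` of a polynomial by powers of `ℓ` so as to bring
them to degree `D`, when `ℓ` is homogeneous of degree one. -/
noncomputable def homogenizeWith (ℓ : MvPolynomial (Fin 3) L) (D : ℕ) :
    MvPolynomial (Fin 3) L →ₗ[L] MvPolynomial (Fin 3) L :=
  ∑ i ∈ Finset.range (D + 1), (LinearMap.mulLeft L (ℓ ^ (D - i))).comp (homogeneousComponent i)

theorem homogenizeWith_apply (ℓ : MvPolynomial (Fin 3) L) (D : ℕ) (f : MvPolynomial (Fin 3) L) :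
    homogenizeWith ℓ D f =
      ∑ i ∈ Finset.range (D + 1), ℓ ^ (D - i) * homogeneousComponent i f := by
  simp [homogenizeWith]

theorem isHomogeneous_homogenizeWith {ℓ : MvPolynomial (Fin 3) L} (hℓ : ℓ.IsHomogeneous 1)
    (D : ℕ) (f : MvPolynomial (Fin 3) L) : (homogenizeWith ℓ D f).IsHomogeneous D := by
  rw [homogenizeWith_apply]
  refine IsHomogeneous.sum _ _ _ fun i hi => ?_
  have := (hℓ.pow (D - i)).mul (homogeneousComponent_isHomogeneous i f)
  rwa [one_mul, Nat.sub_add_cancel (Finset.mem_range_succ_iff.mp hi)] at this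

theorem homogenizeWith_of_isHomogeneous {ℓ f : MvPolynomial (Fin 3) L} {d D : ℕ}
    (hf : f.IsHomogeneous d) (hd : d ≤ D) : homogenizeWith ℓ D f = ℓ ^ (D - d) * f := by
  rw [homogenizeWith_apply, Finset.sum_eq_single d]
  · rw [homogeneousComponent_eq_self hf]
  · intro i _ hi
    rw [homogeneousComponent_of_mem hf, if_neg hi, mul_zero]
  · intro h
    exact absurd (Finset.mem_range_succ_iff.mpr hd) h

/-- The sum telescopes, leaving only the top term. In particular homogenization in a degree above
that of `c` kills `c * (ℓ - 1)`. -/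
theorem homogenizeWith_mul_sub_one {ℓ : MvPolynomial (Fin 3) L} (hℓ : ℓ.IsHomogeneous 1)
    (D : ℕ) (c : MvPolynomial (Fin 3) L) :
    homogenizeWith ℓ D (c * (ℓ - 1)) = -homogeneousComponent D c := by
  rw [mul_sub, mul_one, map_sub, homogenizeWith_apply, homogenizeWith_apply,
    Finset.sum_range_succ', homogeneousComponent_mul_of_isHomogeneous_of_lt hℓ c Nat.one_pos,
    Finset.sum_range_succ]
  have : ∑ i ∈ Finset.range D, ℓ ^ (D - (i + 1)) * homogeneousComponent (i + 1) (c * ℓ) =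
      ∑ i ∈ Finset.range D, ℓ ^ (D - i) * homogeneousComponent i c := by
    refine Finset.sum_congr rfl fun i hi => ?_
    rw [homogeneousComponent_mul_of_isHomogeneous hℓ]
    obtain ⟨e, rfl⟩ := Nat.exists_eq_add_of_lt (Finset.mem_range.mp hi)
    rw [show i + e + 1 - (i + 1) = e by omega, show i + e + 1 - i = e + 1 by omega]
    ring
  rw [this]
  simp

/-- Powers of `ℓ` are congruent to `1` modulo `ℓ - 1`. -/
theorem sub_homogenizeWith_mem {ℓ f : MvPolynomial (Fin 3) L} {D : ℕ} (hf : f.totalDegree ≤ D) :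
    f - homogenizeWith ℓ D f ∈ Ideal.span {ℓ - 1} := by
  have : f = ∑ i ∈ Finset.range (D + 1), homogeneousComponent i f := by
    conv_lhs => rw [← sum_homogeneousComponent f]
    refine Finset.sum_subset (Finset.range_subset_range.mpr (by omega)) fun i _ hi => ?_
    exact homogeneousComponent_eq_zero _ _ (by simpa using hi)
  have h : f - homogenizeWith ℓ D f = ∑ i ∈ Finset.range (D + 1), homogeneousComponent i f -
      homogenizeWith ℓ D f := by rw [← this]
  rw [h, homogenizeWith_apply, ← Finset.sum_sub_distrib]
  refine Ideal.sum_mem _ fun i _ => ?_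
  obtain ⟨g, hg⟩ := sub_one_dvd_pow_sub_one ℓ (D - i)
  refine Ideal.mem_span_singleton.mpr ⟨-g * homogeneousComponent i f, ?_⟩
  linear_combination -(homogeneousComponent i f) * hg

theorem exists_eq_add_mul_of_mem_span {R : Type*} [CommRing R] {a b c f : R}
    (hf : f ∈ Ideal.span {a, b, c}) : ∃ p ∈ Ideal.span {a, b}, ∃ q, f = p + q * c := by
  obtain ⟨x, y, z, rfl⟩ := Submodule.mem_span_triple.mp hf
  exact ⟨x * a + y * b, Ideal.mem_span_pair.mpr ⟨x, y, rfl⟩, z, rfl⟩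

theorem homogeneousComponent_mem_span_pair {A B f : MvPolynomial (Fin 3) L} {m n : ℕ}
    (hA : A.IsHomogeneous m) (hB : B.IsHomogeneous n) (hf : f ∈ Ideal.span {A, B}) (i : ℕ) :
    homogeneousComponent i f ∈ Ideal.span {A, B} := by
  let _ : GradedAlgebra (homogeneousSubmodule (Fin 3) L) := gradedAlgebra
  refine homogeneousComponent_mem_of_mem
    (Ideal.homogeneous_span (homogeneousSubmodule (Fin 3) L) _ ?_) hf i
  rintro x (rfl | rfl)
  · exact ⟨m, hA⟩
  · exact ⟨n, hB⟩

theorem homogenizeWith_mem_span_pair {A B ℓ f : MvPolynomial (Fin 3) L} {m n : ℕ}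
    (hA : A.IsHomogeneous m) (hB : B.IsHomogeneous n) (hf : f ∈ Ideal.span {A, B}) (D : ℕ) :
    homogenizeWith ℓ D f ∈ Ideal.span {A, B} := by
  rw [homogenizeWith_apply]
  refine Ideal.sum_mem _ fun i _ => Ideal.mul_mem_left _ _ ?_
  exact homogeneousComponent_mem_span_pair hA hB hf i

end Homogenization

/-! ### The affine chart and the upper bound for its dimension -/

section AffineRing

/-- The ideal of the common points of two curves in the affine chart `ℓ = 1`. -/
noncomputable def affineIdeal (A B ℓ : MvPolynomial (Fin 3) L) : Ideal (MvPolynomial (Fin 3) L) :=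
  Ideal.span {A, B, ℓ - 1}

/-- The coordinate ring of the intersection of two curves in the affine chart `ℓ = 1`. -/
abbrev AffineRing (A B ℓ : MvPolynomial (Fin 3) L) : Type _ :=
  MvPolynomial (Fin 3) L ⧸ affineIdeal A B ℓ

theorem span_pair_le_affineIdeal (A B ℓ : MvPolynomial (Fin 3) L) :
    Ideal.span {A, B} ≤ affineIdeal A B ℓ :=
  Ideal.span_mono (by rintro x (rfl | rfl) <;> simp)

theorem sub_one_mem_affineIdeal (A B ℓ : MvPolynomial (Fin 3) L) :
    ℓ - 1 ∈ affineIdeal A B ℓ :=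
  Ideal.subset_span (by simp)

theorem exists_isHomogeneous_sub_mem_affineIdeal (A B : MvPolynomial (Fin 3) L)
    {ℓ f : MvPolynomial (Fin 3) L} (hℓ : ℓ.IsHomogeneous 1) {D : ℕ} (hf : f.totalDegree ≤ D) :
    ∃ g : MvPolynomial (Fin 3) L, g.IsHomogeneous D ∧ f - g ∈ affineIdeal A B ℓ :=
  ⟨homogenizeWith ℓ D f, isHomogeneous_homogenizeWith hℓ D f,
    Ideal.span_mono (by simp) (sub_homogenizeWith_mem hf)⟩

/-- Homogenizing `f = p + c * (ℓ - 1)` in a degree `D` above that of `c` removes the last term,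
keeps `p` in the homogeneous ideal `(A, B)`, and turns `f` into `ℓ ^ (D - d) * f`. -/
theorem exists_pow_mul_mem_of_mem_affineIdeal {A B ℓ f : MvPolynomial (Fin 3) L} {m n d : ℕ}
    (hA : A.IsHomogeneous m) (hB : B.IsHomogeneous n) (hℓ : ℓ.IsHomogeneous 1)
    (hf : f.IsHomogeneous d) (hfJ : f ∈ affineIdeal A B ℓ) :
    ∃ k, ℓ ^ k * f ∈ Ideal.span {A, B} := by
  obtain ⟨p, hp, c, rfl⟩ := exists_eq_add_mul_of_mem_span hfJ
  set D := max d (c.totalDegree + 1)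
  refine ⟨D - d, ?_⟩
  rw [← homogenizeWith_of_isHomogeneous hf (le_max_left _ _), map_add,
    homogenizeWith_mul_sub_one hℓ, homogeneousComponent_eq_zero _ _
      (lt_of_lt_of_le (Nat.lt_succ_self _) (le_max_right d (c.totalDegree + 1))), neg_zero, add_zero]
  exact homogenizeWith_mem_span_pair hA hB hp D

theorem finrank_map_mkQ_affineIdeal_le {A B : MvPolynomial (Fin 3) L} {m n : ℕ}
    (hA : A.IsHomogeneous m) (hB : B.IsHomogeneous n) (hA0 : A ≠ 0)
    (hAB : ∀ f, A ∣ B * f → A ∣ f) (ℓ : MvPolynomial (Fin 3) L) {d : ℕ} (hd : m + n ≤ d) :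
    Module.finrank L ((homogeneousSubmodule (Fin 3) L d).map
      (Ideal.Quotient.mkₐ L (affineIdeal A B ℓ)).toLinearMap) ≤ m * n := by
  have h₁ := finrank_map_mkQ_add_finrank_inf (homogeneousSubmodule (Fin 3) L d)
    ((Ideal.span {A, B}).restrictScalars L)
  have h₂ := finrank_map_mkQ_add_finrank_inf (homogeneousSubmodule (Fin 3) L d)
    ((affineIdeal A B ℓ).restrictScalars L)
  rw [finrank_map_mkQ_span_pair hA hB hA0 hAB hd] at h₁
  have h₃ : Module.finrank L (homogeneousSubmodule (Fin 3) L d ⊓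
      (Ideal.span {A, B}).restrictScalars L : Submodule L (MvPolynomial (Fin 3) L)) ≤
      Module.finrank L (homogeneousSubmodule (Fin 3) L d ⊓
        (affineIdeal A B ℓ).restrictScalars L : Submodule L (MvPolynomial (Fin 3) L)) := by
    have : Module.Finite L (homogeneousSubmodule (Fin 3) L d ⊓
        (affineIdeal A B ℓ).restrictScalars L : Submodule L (MvPolynomial (Fin 3) L)) :=
      Submodule.finiteDimensional_inf_left _ _
    exact Submodule.finrank_mono (inf_le_inf_left _
      fun _ hx => span_pair_le_affineIdeal A B ℓ hx)
  change Module.finrank L ((homogeneousSubmodule (Fin 3) L d).map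
      ((affineIdeal A B ℓ).restrictScalars L).mkQ) ≤ _
  omega

/-- A finite independent family lifts to forms of one common large degree, where the bound is known.
Working with `Module.rank` makes this prove finiteness as well. -/
theorem rank_affineRing_le {A B : MvPolynomial (Fin 3) L} {m n : ℕ}
    (hA : A.IsHomogeneous m) (hB : B.IsHomogeneous n) (hA0 : A ≠ 0)
    (hAB : ∀ f, A ∣ B * f → A ∣ f) {ℓ : MvPolynomial (Fin 3) L} (hℓ : ℓ.IsHomogeneous 1) :
    Module.rank L (AffineRing A B ℓ) ≤ (m * n : ℕ) := by
  classical
  refine rank_le fun s hs => ?_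
  choose r hr using fun x : AffineRing A B ℓ => Ideal.Quotient.mk_surjective x
  let d := m + n + s.sup fun x => (r x).totalDegree
  have hle : Submodule.span L (s : Set (AffineRing A B ℓ)) ≤
      (homogeneousSubmodule (Fin 3) L d).map
        (Ideal.Quotient.mkₐ L (affineIdeal A B ℓ)).toLinearMap := by
    rw [Submodule.span_le]
    intro x hx
    obtain ⟨g, hg, hgx⟩ := exists_isHomogeneous_sub_mem_affineIdeal A B hℓ
      (D := d) (f := r x)
      ((Finset.le_sup (f := fun x => (r x).totalDegree) hx).trans (Nat.le_add_left _ _))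
    refine ⟨g, hg, ?_⟩
    change Ideal.Quotient.mk _ g = x
    rw [← hr x]
    exact ((Ideal.Quotient.mk_eq_mk_iff_sub_mem _ _).mpr hgx).symm
  rw [← finrank_span_finset_eq_card hs]
  exact (Submodule.finrank_mono hle).trans
    (finrank_map_mkQ_affineIdeal_le hA hB hA0 hAB ℓ (by omega))

theorem finite_affineRing {A B : MvPolynomial (Fin 3) L} {m n : ℕ}
    (hA : A.IsHomogeneous m) (hB : B.IsHomogeneous n) (hA0 : A ≠ 0)
    (hAB : ∀ f, A ∣ B * f → A ∣ f) {ℓ : MvPolynomial (Fin 3) L} (hℓ : ℓ.IsHomogeneous 1) :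
    Module.Finite L (AffineRing A B ℓ) :=
  Module.rank_lt_aleph0_iff.mp
    ((rank_affineRing_le hA hB hA0 hAB hℓ).trans_lt (Cardinal.natCast_lt_aleph0))

theorem finrank_affineRing_le {A B : MvPolynomial (Fin 3) L} {m n : ℕ}
    (hA : A.IsHomogeneous m) (hB : B.IsHomogeneous n) (hA0 : A ≠ 0)
    (hAB : ∀ f, A ∣ B * f → A ∣ f) {ℓ : MvPolynomial (Fin 3) L} (hℓ : ℓ.IsHomogeneous 1) :
    Module.finrank L (AffineRing A B ℓ) ≤ m * n :=
  Module.finrank_le_of_rank_le (rank_affineRing_le hA hB hA0 hAB hℓ)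

end AffineRing

/-! ### A line missing the common points: the exact dimension -/

section LineAtInfinity

variable [IsAlgClosed L]

/-- By the Nullstellensatz the radical of `I` contains the ideal of the variables, so `I` contains a
power of it. -/
theorem exists_homogeneousSubmodule_le_of_zeros {I : Ideal (MvPolynomial (Fin 3) L)}
    (hI : ∀ v : Fin 3 → L, (∀ f ∈ I, eval v f = 0) → v = 0) :
    ∃ N, ∀ d ≥ N, ∀ f : MvPolynomial (Fin 3) L, f.IsHomogeneous d → f ∈ I := by
  have hle : idealOfVars (Fin 3) L ≤ I.radical := by
    rw [← vanishingIdeal_zeroLocus_eq_radical (K := L) I, idealOfVars, Ideal.span_le]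
    rintro _ ⟨i, rfl⟩ v hv
    have : v = 0 := hI v fun f hf => by simpa [aeval_eq_eval] using hv f hf
    simp [this]
  obtain ⟨N, hN⟩ := Ideal.exists_pow_le_of_le_radical_of_fg hle (idealOfVars_fg _ _)
  refine ⟨N, fun d hd f hf => hN ((mem_pow_idealOfVars_iff _ _).mpr fun x hx => ?_)⟩
  rw [Finsupp.degree_eq_weight_one]
  exact hd.trans_eq (hf (mem_support_iff.mp hx)).symm

/-- If the line `ℓ = 0` misses all common points of two curves, then multiplication by `ℓ` is
injective in high degrees on the homogeneous coordinate ring of the intersection. -/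
theorem exists_mem_span_pair_of_mul_mem {A B ℓ : MvPolynomial (Fin 3) L} {m n : ℕ}
    (hA : A.IsHomogeneous m) (hB : B.IsHomogeneous n) (hA0 : A ≠ 0)
    (hAB : ∀ f, A ∣ B * f → A ∣ f) (hℓ : ℓ.IsHomogeneous 1)
    (hv : ∀ v : Fin 3 → L, eval v A = 0 → eval v B = 0 → eval v ℓ = 0 → v = 0) :
    ∃ N, ∀ d ≥ N, ∀ f : MvPolynomial (Fin 3) L, f.IsHomogeneous d →
      ℓ * f ∈ Ideal.span {A, B} → f ∈ Ideal.span {A, B} := by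
  obtain ⟨N, hN⟩ := exists_homogeneousSubmodule_le_of_zeros (I := Ideal.span {A, B, ℓ})
    fun v h => hv v (h _ (Ideal.subset_span (by simp))) (h _ (Ideal.subset_span (by simp)))
      (h _ (Ideal.subset_span (by simp)))
  refine ⟨max N (m + n), fun d hd f hf hℓf => ?_⟩
  let I : Submodule L (MvPolynomial (Fin 3) L) := (Ideal.span {A, B}).restrictScalars L
  let μ : (MvPolynomial (Fin 3) L ⧸ I) →ₗ[L] (MvPolynomial (Fin 3) L ⧸ I) :=
    I.mapQ I (LinearMap.mulLeft L ℓ) fun x hx => Ideal.mul_mem_left _ _ hx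
  -- Every form of degree `d + 1` lies in `(A, B, ℓ)`, hence is a multiple of `ℓ` modulo `(A, B)`.
  have hsurj : (homogeneousSubmodule (Fin 3) L (d + 1)).map I.mkQ ≤
      ((homogeneousSubmodule (Fin 3) L d).map I.mkQ).map μ := by
    rintro _ ⟨g, hg, rfl⟩
    have hg' := hN (d + 1) (by have := le_max_left N (m + n); omega) g hg
    obtain ⟨p, hp, a, rfl⟩ := exists_eq_add_mul_of_mem_span hg'
    refine ⟨I.mkQ (homogeneousComponent d a),
      ⟨_, homogeneousComponent_isHomogeneous d a, rfl⟩, ?_⟩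
    change I.mkQ (ℓ * homogeneousComponent d a) = I.mkQ (p + a * ℓ)
    rw [← homogeneousComponent_eq_self hg, map_add, homogeneousComponent_mul_of_isHomogeneous hℓ,
      mul_comm ℓ, eq_comm, ← sub_eq_zero, ← map_sub, add_sub_cancel_right]
    refine (Submodule.Quotient.mk_eq_zero _).mpr ?_
    exact homogeneousComponent_mem_span_pair hA hB hp _
  -- Source and target both have dimension `m * n`, so surjectivity forces injectivity.
  have hdisj : Disjoint ((homogeneousSubmodule (Fin 3) L d).map I.mkQ) (LinearMap.ker μ) := by
    refine Submodule.disjoint_ker_of_finrank_le μ ?_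
    have hd' : m + n ≤ d := (le_max_right _ _).trans hd
    rw [finrank_map_mkQ_span_pair hA hB hA0 hAB hd',
      ← finrank_map_mkQ_span_pair hA hB hA0 hAB (hd'.trans d.le_succ)]
    exact Submodule.finrank_mono hsurj
  have h0 : I.mkQ f = 0 := by
    refine (Submodule.disjoint_def.mp hdisj) _ ⟨f, hf, rfl⟩ ?_
    rw [LinearMap.mem_ker]
    exact (Submodule.Quotient.mk_eq_zero _).mpr hℓf
  exact (Submodule.Quotient.mk_eq_zero _).mp h0

theorem finrank_affineRing {A B ℓ : MvPolynomial (Fin 3) L} {m n : ℕ}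
    (hA : A.IsHomogeneous m) (hB : B.IsHomogeneous n) (hA0 : A ≠ 0)
    (hAB : ∀ f, A ∣ B * f → A ∣ f) (hℓ : ℓ.IsHomogeneous 1)
    (hv : ∀ v : Fin 3 → L, eval v A = 0 → eval v B = 0 → eval v ℓ = 0 → v = 0) :
    Module.finrank L (AffineRing A B ℓ) = m * n := by
  refine (finrank_affineRing_le hA hB hA0 hAB hℓ).antisymm ?_
  obtain ⟨N, hN⟩ := exists_mem_span_pair_of_mul_mem hA hB hA0 hAB hℓ hv
  have hpow : ∀ k, ∀ d ≥ N, ∀ f : MvPolynomial (Fin 3) L, f.IsHomogeneous d →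
      ℓ ^ k * f ∈ Ideal.span {A, B} → f ∈ Ideal.span {A, B} := by
    intro k
    induction k with
    | zero => simp
    | succ k ih =>
      intro d hd f hf h
      refine hN d hd f hf (ih (1 + d) (by omega) _ (hℓ.mul hf) ?_)
      rwa [pow_succ, mul_assoc] at h
  set d := max N (m + n)
  -- In this degree dehomogenizing loses nothing, so the forms of degree `d` already span `m * n`
  -- dimensions of the chart ring.
  have heq : homogeneousSubmodule (Fin 3) L d ⊓ (affineIdeal A B ℓ).restrictScalars L =
      homogeneousSubmodule (Fin 3) L d ⊓ (Ideal.span {A, B}).restrictScalars L := by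
    ext f
    refine and_congr_right fun hf => ⟨fun h => ?_, fun h => span_pair_le_affineIdeal A B ℓ h⟩
    obtain ⟨k, hk⟩ := exists_pow_mul_mem_of_mem_affineIdeal hA hB hℓ hf h
    exact hpow k d (le_max_left _ _) f hf hk
  have h₁ := finrank_map_mkQ_add_finrank_inf (homogeneousSubmodule (Fin 3) L d)
    ((Ideal.span {A, B}).restrictScalars L)
  have h₂ := finrank_map_mkQ_add_finrank_inf (homogeneousSubmodule (Fin 3) L d)
    ((affineIdeal A B ℓ).restrictScalars L)
  rw [finrank_map_mkQ_span_pair hA hB hA0 hAB (le_max_right _ _)] at h₁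
  rw [heq] at h₂
  have := finite_affineRing hA hB hA0 hAB hℓ
  have : Module.Finite L
      (MvPolynomial (Fin 3) L ⧸ (affineIdeal A B ℓ).restrictScalars L) := this
  have h₃ := Submodule.finrank_le ((homogeneousSubmodule (Fin 3) L d).map
    ((affineIdeal A B ℓ).restrictScalars L).mkQ)
  change m * n ≤ Module.finrank L
      (MvPolynomial (Fin 3) L ⧸ (affineIdeal A B ℓ).restrictScalars L)
  omega

end LineAtInfinity

/-! ### Points in the chart and finiteness of the intersection -/

section AffinePoint

theorem aeval_mul_of_isHomogeneous {R : Type*} [CommRing R] [Algebra L R]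
    {F : MvPolynomial (Fin 3) L} {d : ℕ} (hF : F.IsHomogeneous d) (r : R) (x : Fin 3 → R) :
    aeval (fun i => r * x i) F = r ^ d * aeval x F := by
  rw [aeval_def, aeval_def, eval₂_eq', eval₂_eq', Finset.mul_sum]
  refine Finset.sum_congr rfl fun e he => ?_
  have hd : ∑ i, e i = d := by
    rw [← hF (mem_support_iff.mp he), ← Finsupp.degree_eq_sum, Finsupp.degree_eq_weight_one]
    rfl
  simp only [mul_pow, Finset.prod_mul_distrib]
  rw [Finset.prod_pow_eq_pow_sum, hd]
  ring

/-- The representative of the point `P` in the affine chart `ℓ = 1`. -/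
noncomputable def affinePoint (ℓ : MvPolynomial (Fin 3) L) (P : Plane L) : Fin 3 → L :=
  fun i => (eval P.rep ℓ)⁻¹ * P.rep i

theorem eval_affinePoint {F : MvPolynomial (Fin 3) L} {d : ℕ} (hF : F.IsHomogeneous d)
    (ℓ : MvPolynomial (Fin 3) L) (P : Plane L) :
    eval (affinePoint ℓ P) F = (eval P.rep ℓ)⁻¹ ^ d * eval P.rep F := by
  simpa only [coe_aeval_eq_eval] using! aeval_mul_of_isHomogeneous hF (eval P.rep ℓ)⁻¹ P.rep

theorem eval_affinePoint_self {ℓ : MvPolynomial (Fin 3) L} (hℓ : ℓ.IsHomogeneous 1) {P : Plane L}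
    (hP : ¬ VanishesAt ℓ P) : eval (affinePoint ℓ P) ℓ = 1 := by
  rw [eval_affinePoint hℓ, pow_one]
  exact inv_mul_cancel₀ hP

theorem eval_affinePoint_eq_zero_iff {F ℓ : MvPolynomial (Fin 3) L} {d : ℕ}
    (hF : F.IsHomogeneous d) {P : Plane L} (hP : ¬ VanishesAt ℓ P) :
    eval (affinePoint ℓ P) F = 0 ↔ VanishesAt F P := by
  rw [eval_affinePoint hF, mul_eq_zero, or_iff_right (pow_ne_zero _ (inv_ne_zero hP))]
  rfl

theorem mk_affinePoint {ℓ : MvPolynomial (Fin 3) L} {P : Plane L}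
    (h : affinePoint ℓ P ≠ 0) : Projectivization.mk L (affinePoint ℓ P) h = P := by
  conv_rhs => rw [← P.mk_rep]
  exact (Projectivization.mk_eq_mk_iff' L _ _ _ _).mpr ⟨(eval P.rep ℓ)⁻¹, rfl⟩

theorem affinePoint_ne_zero {ℓ : MvPolynomial (Fin 3) L} {P : Plane L}
    (hP : ¬ VanishesAt ℓ P) : affinePoint ℓ P ≠ 0 := fun h =>
  P.rep_nonzero (funext fun i => by
    simpa [affinePoint, show eval P.rep ℓ ≠ 0 from hP] using congrFun h i)

theorem affinePoint_injOn {ℓ : MvPolynomial (Fin 3) L} {P P' : Plane L}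
    (hP : ¬ VanishesAt ℓ P) (hP' : ¬ VanishesAt ℓ P') (h : affinePoint ℓ P = affinePoint ℓ P') :
    P = P' := by
  rw [← mk_affinePoint (affinePoint_ne_zero hP), ← mk_affinePoint (affinePoint_ne_zero hP')]
  simp only [h]

theorem affinePoint_mk {ℓ : MvPolynomial (Fin 3) L} (hℓ : ℓ.IsHomogeneous 1) {v : Fin 3 → L}
    (hv : v ≠ 0) (hvℓ : eval v ℓ = 1) : affinePoint ℓ (Projectivization.mk L v hv) = v := by
  obtain ⟨a, ha⟩ := Projectivization.exists_smul_eq_mk_rep L v hv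
  have h : eval (Projectivization.mk L v hv).rep ℓ = a := by
    rw [← ha]
    have := aeval_mul_of_isHomogeneous hℓ (a : L) v
    change eval ((a : L) • v) ℓ = (a : L) ^ 1 * eval v ℓ at this
    rwa [hvℓ, pow_one, mul_one] at this
  funext i
  rw [affinePoint, h, ← ha]
  exact inv_mul_cancel_left₀ a.ne_zero _

/-- Over an infinite field, finitely many proper subspaces do not cover the dual space. -/
theorem exists_linearForm [Infinite L] (s : Set (Plane L)) (hs : s.Finite) :
    ∃ ℓ : MvPolynomial (Fin 3) L, ℓ.IsHomogeneous 1 ∧ ∀ P ∈ s, ¬ VanishesAt ℓ P := by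
  have := hs.to_subtype
  obtain ⟨f, hf⟩ := Module.exists_dual_forall_apply_ne_zero (K := L) (fun P : s => P.1.rep)
    fun P => P.1.rep_nonzero
  refine ⟨∑ i, C (f fun j => if i = j then 1 else 0) * X i, ?_, fun P hP h => hf ⟨P, hP⟩ ?_⟩
  · exact IsHomogeneous.sum _ _ _ fun i _ => by
      simpa using (isHomogeneous_C _ _).mul (isHomogeneous_X _ i)
  · rw [LinearMap.pi_apply_eq_sum_univ f]
    simpa [VanishesAt, mul_comm] using h

/-- Evaluation of functions on the affine intersection of two curves at a common point. -/
noncomputable def evalAt {A B ℓ : MvPolynomial (Fin 3) L} (v : Fin 3 → L)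
    (hA : eval v A = 0) (hB : eval v B = 0) (hℓ : eval v ℓ = 1) : AffineRing A B ℓ →ₐ[L] L :=
  Ideal.Quotient.liftₐ (affineIdeal A B ℓ) (aeval v) fun f hf => by
    have : affineIdeal A B ℓ ≤ RingHom.ker (aeval v : MvPolynomial (Fin 3) L →ₐ[L] L) := by
      refine Ideal.span_le.mpr ?_
      rintro x (rfl | rfl | rfl) <;> simp [aeval_eq_eval, hA, hB, hℓ]
    exact this hf

theorem evalAt_mk {A B ℓ : MvPolynomial (Fin 3) L} (v : Fin 3 → L)
    (hA : eval v A = 0) (hB : eval v B = 0) (hℓ : eval v ℓ = 1) (f : MvPolynomial (Fin 3) L) :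
    evalAt v hA hB hℓ (Ideal.Quotient.mk _ f) = eval v f := by
  rw [← aeval_eq_eval]
  rfl

theorem finite_commonPoints [Infinite L] {A B : MvPolynomial (Fin 3) L} {m n : ℕ}
    (hA : A.IsHomogeneous m) (hB : B.IsHomogeneous n) (hA0 : A ≠ 0)
    (hAB : ∀ f, A ∣ B * f → A ∣ f) : (commonPoints A B).Finite := by
  by_contra hinf
  obtain ⟨s, hs, hcard⟩ := Set.Infinite.exists_subset_card_eq hinf (m * n + 1)
  -- The line avoids only `m * n + 1` chosen points; their evaluations are too many for the upper
  -- bound, which holds for every `ℓ`.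
  obtain ⟨ℓ, hℓ, hℓs⟩ := exists_linearForm (s : Set (Plane L)) s.finite_toSet
  have := finite_affineRing hA hB hA0 hAB hℓ
  let e : s → (AffineRing A B ℓ →ₐ[L] L) := fun P =>
    evalAt (affinePoint ℓ P.1) ((eval_affinePoint_eq_zero_iff hA (hℓs _ P.2)).mpr (hs P.2).1)
      ((eval_affinePoint_eq_zero_iff hB (hℓs _ P.2)).mpr (hs P.2).2)
      (eval_affinePoint_self hℓ (hℓs _ P.2))
  have he : Function.Injective e := fun P P' h => by
    refine Subtype.ext (affinePoint_injOn (hℓs _ P.2) (hℓs _ P'.2) (funext fun i => ?_))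
    have := DFunLike.congr_fun h (Ideal.Quotient.mk _ (X i))
    simpa only [e, evalAt_mk, eval_X] using this
  have h₁ := Nat.card_le_card_of_injective e he
  have h₂ := card_algHom_le_finrank L (AffineRing A B ℓ) L
  have h₃ := finrank_affineRing_le hA hB hA0 hAB hℓ
  have h₄ : Nat.card s = m * n + 1 := by simp [hcard]
  omega

end AffinePoint

/-! ### Local rings of the intersection as localizations of the chart ring -/

section Localization

/-- The function `F / ℓ ^ d` in the local ring at `P`, for `F` homogeneous of degree `d`, extended
linearly to all polynomials. -/
noncomputable def dehomogenize {ℓ : MvPolynomial (Fin 3) L} (hℓ : ℓ.IsHomogeneous 1) {P : Plane L}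
    (hP : ¬ VanishesAt ℓ P) : MvPolynomial (Fin 3) L →ₐ[L] localRing P :=
  aeval fun i => ⟨frac (X i) ℓ, 1, X i, ℓ, isHomogeneous_X _ i, hℓ, hP, rfl⟩

theorem coe_dehomogenize {ℓ : MvPolynomial (Fin 3) L} (hℓ : ℓ.IsHomogeneous 1) {P : Plane L}
    (hP : ¬ VanishesAt ℓ P) {F : MvPolynomial (Fin 3) L} {d : ℕ} (hF : F.IsHomogeneous d) :
    (dehomogenize hℓ hP F : FractionRing (MvPolynomial (Fin 3) L)) = frac F (ℓ ^ d) := by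
  have h₁ : (dehomogenize hℓ hP F : FractionRing (MvPolynomial (Fin 3) L)) =
      aeval (fun i => frac (X i) ℓ) F := by
    change (localRing P).val (dehomogenize hℓ hP F) = _
    exact DFunLike.congr_fun (comp_aeval _ (localRing P).val) F
  have h₂ : (fun i => frac (X i) ℓ) = fun i : Fin 3 =>
      (algebraMap (MvPolynomial (Fin 3) L) (FractionRing (MvPolynomial (Fin 3) L)) ℓ)⁻¹ *
      algebraMap (MvPolynomial (Fin 3) L) (FractionRing (MvPolynomial (Fin 3) L)) (X i) := by
    funext i
    rw [frac, div_eq_inv_mul]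
  rw [h₁, h₂, aeval_mul_of_isHomogeneous hF, frac, div_eq_inv_mul, map_pow, inv_pow,
    show (fun i : Fin 3 => algebraMap (MvPolynomial (Fin 3) L)
      (FractionRing (MvPolynomial (Fin 3) L)) (X i)) = algebraMap _ _ ∘ X from rfl,
    aeval_algebraMap_apply, aeval_X_left_apply]

theorem frac_eq_frac_iff {S T S' T' : MvPolynomial (Fin 3) L} {P : Plane L}
    (hT : ¬ VanishesAt T P) (hT' : ¬ VanishesAt T' P) :
    frac S T = frac S' T' ↔ S * T' = S' * T := by
  rw [frac, frac, div_eq_div_iff (ne_zero_of_not_vanishesAt hT) (ne_zero_of_not_vanishesAt hT'),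
    ← map_mul, ← map_mul, (IsFractionRing.injective (MvPolynomial (Fin 3) L)
      (FractionRing (MvPolynomial (Fin 3) L))).eq_iff]

theorem not_vanishesAt_pow {ℓ : MvPolynomial (Fin 3) L} {P : Plane L}
    (hP : ¬ VanishesAt ℓ P) (d : ℕ) : ¬ VanishesAt (ℓ ^ d) P := by
  simp only [VanishesAt, map_pow] at *
  exact pow_ne_zero _ hP

/-- The map from functions on the affine intersection of two curves to germs at a point. -/
noncomputable def germ {A B ℓ : MvPolynomial (Fin 3) L} {m n : ℕ} (hA : A.IsHomogeneous m)
    (hB : B.IsHomogeneous n) (hℓ : ℓ.IsHomogeneous 1) {P : Plane L} (hP : ¬ VanishesAt ℓ P) :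
    AffineRing A B ℓ →ₐ[L] localRing P ⧸ localIdeal A B P :=
  Ideal.Quotient.liftₐ (affineIdeal A B ℓ)
    ((Ideal.Quotient.mkₐ L (localIdeal A B P)).comp (dehomogenize hℓ hP)) fun f hf => by
    have : affineIdeal A B ℓ ≤ (localIdeal A B P).comap (dehomogenize hℓ hP) := by
      refine Ideal.span_le.mpr ?_
      rintro x (rfl | rfl | rfl)
      · exact ⟨m, 1, 0, ℓ ^ m, by simpa using hA, by simpa using hℓ.pow m,
          not_vanishesAt_pow hP m, by simpa using coe_dehomogenize hℓ hP hA⟩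
      · exact ⟨n, 0, 1, ℓ ^ n, by simpa using hB, by simpa using hℓ.pow n,
          not_vanishesAt_pow hP n, by simpa using coe_dehomogenize hℓ hP hB⟩
      · have : dehomogenize hℓ hP ℓ = 1 := Subtype.ext (by
          rw [coe_dehomogenize hℓ hP hℓ, pow_one, frac, div_self (ne_zero_of_not_vanishesAt hP)]
          rfl)
        change dehomogenize hℓ hP (ℓ - 1) ∈ localIdeal A B P
        rw [map_sub, map_one, this, sub_self]
        exact zero_mem _
    exact Ideal.Quotient.eq_zero_iff_mem.mpr (this hf)

theorem germ_mk {A B ℓ : MvPolynomial (Fin 3) L} {m n : ℕ} (hA : A.IsHomogeneous m)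
    (hB : B.IsHomogeneous n) (hℓ : ℓ.IsHomogeneous 1) {P : Plane L} (hP : ¬ VanishesAt ℓ P)
    (f : MvPolynomial (Fin 3) L) :
    germ hA hB hℓ hP (Ideal.Quotient.mk _ f) = Ideal.Quotient.mk _ (dehomogenize hℓ hP f) :=
  rfl

theorem exists_isHomogeneous_mk_eq {A B ℓ : MvPolynomial (Fin 3) L} (hℓ : ℓ.IsHomogeneous 1)
    (q : AffineRing A B ℓ) :
    ∃ (d : ℕ) (f : MvPolynomial (Fin 3) L), f.IsHomogeneous d ∧ Ideal.Quotient.mk _ f = q := by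
  obtain ⟨f, rfl⟩ := Ideal.Quotient.mk_surjective q
  obtain ⟨g, hg, hfg⟩ := exists_isHomogeneous_sub_mem_affineIdeal A B hℓ (le_refl f.totalDegree)
  exact ⟨_, g, hg, ((Ideal.Quotient.mk_eq_mk_iff_sub_mem _ _).mpr hfg).symm⟩

/-- The local ring of the intersection of two curves at a common point is the localization of the
affine coordinate ring at the corresponding maximal ideal. -/
theorem isLocalization_germ {A B ℓ : MvPolynomial (Fin 3) L} {m n : ℕ} (hA : A.IsHomogeneous m)
    (hB : B.IsHomogeneous n) (hℓ : ℓ.IsHomogeneous 1) {P : Plane L} (hP : ¬ VanishesAt ℓ P)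
    (hPA : eval (affinePoint ℓ P) A = 0) (hPB : eval (affinePoint ℓ P) B = 0)
    (hPℓ : eval (affinePoint ℓ P) ℓ = 1) (𝔪 : Ideal (AffineRing A B ℓ)) [𝔪.IsPrime]
    (h𝔪 : 𝔪 = RingHom.ker (evalAt (affinePoint ℓ P) hPA hPB hPℓ)) :
    letI := RingHom.toAlgebra (R := AffineRing A B ℓ) (S := localRing P ⧸ localIdeal A B P)
      (germ hA hB hℓ hP)
    IsLocalization.AtPrime (localRing P ⧸ localIdeal A B P) 𝔪 := by
  let _ := RingHom.toAlgebra (R := AffineRing A B ℓ) (S := localRing P ⧸ localIdeal A B P)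
      (germ hA hB hℓ hP)
  have hmem : ∀ {d : ℕ} {f : MvPolynomial (Fin 3) L}, f.IsHomogeneous d →
      (Ideal.Quotient.mk _ f ∈ 𝔪.primeCompl ↔ ¬ VanishesAt f P) := fun {d f} hf => by
    rw [Ideal.mem_primeCompl_iff, h𝔪, RingHom.mem_ker, evalAt_mk,
      eval_affinePoint_eq_zero_iff hf hP]
  refine ⟨?_, ?_, ?_⟩
  -- Units: `f / ℓ ^ d` has inverse `ℓ ^ d / f` when `f` does not vanish at `P`.
  · rintro ⟨q, hq⟩
    obtain ⟨d, f, hf, rfl⟩ := exists_isHomogeneous_mk_eq hℓ q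
    have hfP := (hmem hf).mp hq
    have hpow : (ℓ ^ d).IsHomogeneous d := by simpa using hℓ.pow d
    change IsUnit (Ideal.Quotient.mk (localIdeal A B P) (dehomogenize hℓ hP f))
    refine IsUnit.map _ (IsUnit.of_mul_eq_one
      ⟨frac (ℓ ^ d) f, d, ℓ ^ d, f, hpow, hf, hfP, rfl⟩ (Subtype.ext ?_))
    change (dehomogenize hℓ hP f : FractionRing (MvPolynomial (Fin 3) L)) * frac (ℓ ^ d) f = 1
    rw [coe_dehomogenize hℓ hP hf, frac_mul_frac, frac, mul_comm]
    exact div_self (ne_zero_of_not_vanishesAt (not_vanishesAt_mul (not_vanishesAt_pow hP d) hfP))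
  -- Fractions: `S / T` is the quotient of `S / ℓ ^ d` by `T / ℓ ^ d`.
  · intro z
    obtain ⟨⟨_, d, S, T, hS, hT, hTP, rfl⟩, rfl⟩ := Ideal.Quotient.mk_surjective z
    refine ⟨(Ideal.Quotient.mk _ S, ⟨Ideal.Quotient.mk _ T, (hmem hT).mpr hTP⟩), ?_⟩
    change Ideal.Quotient.mk (localIdeal A B P) _ *
      Ideal.Quotient.mk (localIdeal A B P) (dehomogenize hℓ hP T) =
      Ideal.Quotient.mk (localIdeal A B P) (dehomogenize hℓ hP S)
    rw [← map_mul]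
    congr 1
    refine Subtype.ext ?_
    change frac S T * (dehomogenize hℓ hP T : FractionRing (MvPolynomial (Fin 3) L)) = _
    rw [coe_dehomogenize hℓ hP hT, coe_dehomogenize hℓ hP hS, frac_mul_frac,
      frac_eq_frac_iff (not_vanishesAt_mul hTP (not_vanishesAt_pow hP d)) (not_vanishesAt_pow hP d)]
    ring
  -- Kernel: `f / ℓ ^ d = (M A + N B) / T` gives `f T = (M A + N B) ℓ ^ d`, so `T`, invertible at
  -- `P`, annihilates the class of `f`.
  · intro x y hxy
    obtain ⟨d, f, hf, hfq⟩ := exists_isHomogeneous_mk_eq hℓ (x - y)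
    have h0 : germ hA hB hℓ hP (x - y) = 0 := by
      rw [map_sub]
      exact sub_eq_zero.mpr hxy
    rw [← hfq, germ_mk, Ideal.Quotient.eq_zero_iff_mem] at h0
    obtain ⟨e, M, N, T, -, hT, hTP, h⟩ := h0
    rw [coe_dehomogenize hℓ hP hf, frac_eq_frac_iff (not_vanishesAt_pow hP d) hTP] at h
    refine ⟨⟨Ideal.Quotient.mk _ T, (hmem hT).mpr hTP⟩, ?_⟩
    rw [← sub_eq_zero, ← mul_sub, ← hfq, ← map_mul, Ideal.Quotient.eq_zero_iff_mem, mul_comm, h]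
    exact Ideal.mul_mem_right _ _ (span_pair_le_affineIdeal A B ℓ
      (Ideal.mem_span_pair.mpr ⟨M, N, rfl⟩))

end Localization

/-! ### Maximal ideals, common points and the Artinian decomposition -/

section Multiplicity

/-- If `A` does not vanish at `P`, then `1 = A / A` lies in the ideal, and likewise for `B`.
Conversely `1 = (M A + N B) / T` at a common point would give `T(P) = 0`. -/
theorem localIdeal_eq_top_iff {L : Type*} [Field L] {A B : MvPolynomial (Fin 3) L} {m n : ℕ}
    (hA : A.IsHomogeneous m) (hB : B.IsHomogeneous n) (P : Plane L) :
    localIdeal A B P = ⊤ ↔ P ∉ commonPoints A B := by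
  rw [Ideal.eq_top_iff_one]
  constructor
  · rintro ⟨d, M, N, T, -, -, hTP, h⟩ ⟨hPA, hPB⟩
    have h' : frac 1 1 = frac (M * A + N * B) T := by
      rw [← h]
      simp [frac]
    rw [frac_eq_frac_iff (not_vanishesAt_one P) hTP, one_mul, mul_one] at h'
    simp only [VanishesAt] at hPA hPB hTP
    exact hTP (by rw [h']; simp [hPA, hPB])
  · intro h
    rcases not_and_or.mp h with hP | hP
    · refine ⟨m, 1, 0, A, by simpa using hA, hA, hP, ?_⟩
      simp [frac, div_self (ne_zero_of_not_vanishesAt hP)]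
    · refine ⟨n, 0, 1, B, by simpa using hB, hB, hP, ?_⟩
      simp [frac, div_self (ne_zero_of_not_vanishesAt hP)]

theorem nontrivial_localQuotient_iff {L : Type*} [Field L] {A B : MvPolynomial (Fin 3) L}
    {m n : ℕ} (hA : A.IsHomogeneous m) (hB : B.IsHomogeneous n) (P : Plane L) :
    Nontrivial (localRing P ⧸ localIdeal A B P) ↔ P ∈ commonPoints A B := by
  rw [Ideal.Quotient.nontrivial_iff, Ne, localIdeal_eq_top_iff hA hB, not_not]

variable {A B ℓ : MvPolynomial (Fin 3) L} {m n : ℕ}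

/-- The maximal ideal of the affine coordinate ring at a common point of two curves. -/
noncomputable def maximalIdealAt (hA : A.IsHomogeneous m) (hB : B.IsHomogeneous n)
    (hℓ : ℓ.IsHomogeneous 1) (hℓP : ∀ P ∈ commonPoints A B, ¬ VanishesAt ℓ P)
    (P : commonPoints A B) : MaximalSpectrum (AffineRing A B ℓ) :=
  ⟨RingHom.ker (evalAt (affinePoint ℓ P.1)
      ((eval_affinePoint_eq_zero_iff hA (hℓP _ P.2)).mpr P.2.1)
      ((eval_affinePoint_eq_zero_iff hB (hℓP _ P.2)).mpr P.2.2)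
      (eval_affinePoint_self hℓ (hℓP _ P.2)) : AffineRing A B ℓ →ₐ[L] L),
    RingHom.ker_isMaximal_of_surjective _ fun c => ⟨algebraMap L _ c, by simp⟩⟩

theorem mk_mem_maximalIdealAt (hA : A.IsHomogeneous m) (hB : B.IsHomogeneous n)
    (hℓ : ℓ.IsHomogeneous 1) (hℓP : ∀ P ∈ commonPoints A B, ¬ VanishesAt ℓ P)
    (P : commonPoints A B) (f : MvPolynomial (Fin 3) L) :
    Ideal.Quotient.mk _ f ∈ (maximalIdealAt hA hB hℓ hℓP P).asIdeal ↔
      eval (affinePoint ℓ P.1) f = 0 := by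
  rw [maximalIdealAt, RingHom.mem_ker, evalAt_mk]

theorem maximalIdealAt_injective (hA : A.IsHomogeneous m) (hB : B.IsHomogeneous n)
    (hℓ : ℓ.IsHomogeneous 1) (hℓP : ∀ P ∈ commonPoints A B, ¬ VanishesAt ℓ P) :
    Function.Injective (maximalIdealAt hA hB hℓ hℓP) := fun P P' h => by
  refine Subtype.ext (affinePoint_injOn (hℓP _ P.2) (hℓP _ P'.2) (funext fun i => ?_))
  have h₁ := (mk_mem_maximalIdealAt hA hB hℓ hℓP P
    (X i - C (affinePoint ℓ P.1 i))).mpr (by simp)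
  rw [h, mk_mem_maximalIdealAt] at h₁
  exact (sub_eq_zero.mp (by simpa using h₁)).symm

/-- By the Nullstellensatz a maximal ideal is evaluation at some `v`; since `ℓ` takes the value `1`
there, `v` is nonzero and is the chart representative of its projective point. -/
theorem maximalIdealAt_surjective [IsAlgClosed L] (hA : A.IsHomogeneous m)
    (hB : B.IsHomogeneous n) (hℓ : ℓ.IsHomogeneous 1)
    (hℓP : ∀ P ∈ commonPoints A B, ¬ VanishesAt ℓ P) :
    Function.Surjective (maximalIdealAt hA hB hℓ hℓP) := fun 𝔪 => by
  have h𝔪 := 𝔪.isMaximal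
  obtain ⟨v, hv⟩ := eq_vanishingIdeal_singleton_of_isMaximal L
    (Ideal.comap_isMaximal_of_surjective (Ideal.Quotient.mk (affineIdeal A B ℓ))
      Ideal.Quotient.mk_surjective (K := 𝔪.asIdeal))
  have hmem : ∀ f, Ideal.Quotient.mk _ f ∈ 𝔪.asIdeal ↔ eval v f = 0 := fun f => by
    rw [← Ideal.mem_comap, hv, mem_vanishingIdeal_singleton_iff, aeval_eq_eval]
  have hJ : ∀ f ∈ affineIdeal A B ℓ, eval v f = 0 := fun f hf => by
    rw [← hmem, Ideal.Quotient.eq_zero_iff_mem.mpr hf]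
    exact zero_mem _
  have hvA : eval v A = 0 := hJ A (Ideal.subset_span (by simp))
  have hvB : eval v B = 0 := hJ B (Ideal.subset_span (by simp))
  have hvℓ : eval v ℓ = 1 := by
    simpa [sub_eq_zero] using hJ _ (sub_one_mem_affineIdeal A B ℓ)
  have hv0 : v ≠ 0 := by
    rintro rfl
    have := aeval_mul_of_isHomogeneous hℓ (0 : L) 0
    change eval (fun _ => (0 : L) * 0) ℓ = _ at this
    simp only [mul_zero, pow_one, zero_mul] at this
    exact one_ne_zero (hvℓ.symm.trans this)
  refine ⟨⟨Projectivization.mk L v hv0, (vanishesAt_mk_iff hA v hv0).mpr hvA,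
    (vanishesAt_mk_iff hB v hv0).mpr hvB⟩, MaximalSpectrum.ext (Ideal.ext fun q => ?_)⟩
  obtain ⟨f, rfl⟩ := Ideal.Quotient.mk_surjective q
  rw [mk_mem_maximalIdealAt, hmem, affinePoint_mk hℓ hv0 hvℓ]

/-- The stalk of the affine intersection at a common point is the local ring of the intersection. -/
noncomputable def localizationEquiv (hA : A.IsHomogeneous m) (hB : B.IsHomogeneous n)
    (hℓ : ℓ.IsHomogeneous 1) (hℓP : ∀ P ∈ commonPoints A B, ¬ VanishesAt ℓ P)
    (P : commonPoints A B) :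
    Localization.AtPrime (maximalIdealAt hA hB hℓ hℓP P).asIdeal ≃ₗ[L]
      localRing P.1 ⧸ localIdeal A B P.1 :=
  letI := RingHom.toAlgebra (R := AffineRing A B ℓ) (S := localRing P.1 ⧸ localIdeal A B P.1)
    (germ hA hB hℓ (hℓP _ P.2))
  haveI : IsLocalization.AtPrime (localRing P.1 ⧸ localIdeal A B P.1)
      (maximalIdealAt hA hB hℓ hℓP P).asIdeal :=
    isLocalization_germ hA hB hℓ (hℓP _ P.2) _ _ _ _ rfl
  haveI : IsScalarTower L (AffineRing A B ℓ) (localRing P.1 ⧸ localIdeal A B P.1) :=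
    IsScalarTower.of_algebraMap_eq fun c => ((germ hA hB hℓ (hℓP _ P.2)).commutes c).symm
  (IsLocalization.algEquiv (maximalIdealAt hA hB hℓ hℓP P).asIdeal.primeCompl
    (Localization.AtPrime (maximalIdealAt hA hB hℓ hℓP P).asIdeal)
    (localRing P.1 ⧸ localIdeal A B P.1)).toLinearEquiv.restrictScalars L

/-- An Artinian ring surjects onto each of its localizations. -/
theorem finite_localization_of_finite (R : Type*) [CommRing R] [Algebra L R] [Module.Finite L R]
    (M : Submonoid R) : Module.Finite L (Localization M) :=
  have : IsArtinianRing R := IsArtinianRing.of_finite L R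
  Module.Finite.of_surjective (IsScalarTower.toAlgHom L R (Localization M)).toLinearMap
    (IsArtinianRing.localization_surjective M _)

theorem finrank_eq_finsum_localization (L R : Type*) [Field L] [CommRing R] [Algebra L R]
    [Module.Finite L R] :
    Module.finrank L R =
      ∑ᶠ 𝔪 : MaximalSpectrum R, Module.finrank L (Localization.AtPrime 𝔪.asIdeal) := by
  have : IsArtinianRing R := IsArtinianRing.of_finite L R
  have := fun 𝔪 : MaximalSpectrum R => finite_localization_of_finite (L := L) R 𝔪.asIdeal.primeCompl
  have := Fintype.ofFinite (MaximalSpectrum R)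
  rw [finsum_eq_sum_of_fintype, ← Module.finrank_pi_fintype]
  exact ((MaximalSpectrum.toPiLocalizationEquiv R).toLinearEquiv.restrictScalars L).finrank_eq

end Multiplicity

/-! ### Finite multiplicities and their sum -/

theorem finite_localQuotient_of_notMem {L : Type*} [Field L] {A B : MvPolynomial (Fin 3) L}
    {m n : ℕ} (hA : A.IsHomogeneous m) (hB : B.IsHomogeneous n) {P : Plane L}
    (hP : P ∉ commonPoints A B) : Module.Finite L (localRing P ⧸ localIdeal A B P) := by
  rw [← nontrivial_localQuotient_iff hA hB, not_nontrivial_iff_subsingleton] at hP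
  exact Module.Finite.of_finite

theorem finite_localQuotient {L : Type*} [Field L] [Infinite L] {A B : MvPolynomial (Fin 3) L}
    {m n : ℕ} (hA : A.IsHomogeneous m) (hB : B.IsHomogeneous n) (hA0 : A ≠ 0)
    (hAB : ∀ f, A ∣ B * f → A ∣ f) (P : Plane L) :
    Module.Finite L (localRing P ⧸ localIdeal A B P) := by
  by_cases hP : P ∈ commonPoints A B
  · obtain ⟨ℓ, hℓ, hℓP⟩ := exists_linearForm _ (finite_commonPoints hA hB hA0 hAB)
    have := finite_affineRing hA hB hA0 hAB hℓ
    have := finite_localization_of_finite (L := L) (AffineRing A B ℓ)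
      (maximalIdealAt hA hB hℓ hℓP ⟨P, hP⟩).asIdeal.primeCompl
    exact Module.Finite.equiv (localizationEquiv hA hB hℓ hℓP ⟨P, hP⟩)
  · exact finite_localQuotient_of_notMem hA hB hP

theorem finsum_intersectionMultiplicity {L : Type*} [Field L] [IsAlgClosed L]
    {A B : MvPolynomial (Fin 3) L} {m n : ℕ} (hA : A.IsHomogeneous m) (hB : B.IsHomogeneous n)
    (hA0 : A ≠ 0) (hAB : ∀ f, A ∣ B * f → A ∣ f) :
    ∑ᶠ P ∈ commonPoints A B, intersectionMultiplicity A B P = m * n := by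
  have : Infinite L := IsAlgClosed.instInfinite
  obtain ⟨ℓ, hℓ, hℓP⟩ := exists_linearForm _ (finite_commonPoints hA hB hA0 hAB)
  have := finite_affineRing hA hB hA0 hAB hℓ
  have hv : ∀ v : Fin 3 → L, eval v A = 0 → eval v B = 0 → eval v ℓ = 0 → v = 0 := by
    intro v hvA hvB hvℓ
    by_contra hv0
    exact hℓP (Projectivization.mk L v hv0) ⟨(vanishesAt_mk_iff hA v hv0).mpr hvA,
      (vanishesAt_mk_iff hB v hv0).mpr hvB⟩ ((vanishesAt_mk_iff hℓ v hv0).mpr hvℓ)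
  rw [← finrank_affineRing hA hB hA0 hAB hℓ hv, finrank_eq_finsum_localization,
    ← finsum_set_coe_eq_finsum_mem]
  exact finsum_eq_of_bijective _
    ⟨maximalIdealAt_injective hA hB hℓ hℓP, maximalIdealAt_surjective hA hB hℓ hℓP⟩
    fun P => (localizationEquiv hA hB hℓ hℓP P).finrank_eq.symm

end PlaneCurve

theorem mainTheorem1 {K : Type*} [Field K] {L : Type*} [Field L] [Algebra K L] [IsAlgClosure K L]
    (A B : MvPolynomial (Fin 3) K) (m n : ℕ)
    (hA : A.IsHomogeneous m) (hB : B.IsHomogeneous n)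
    (hAB : ∀ D : MvPolynomial (Fin 3) K, D ∣ A → D ∣ B → ∃ c : K, D = C c) :
    (PlaneCurve.commonPoints (map (algebraMap K L) A) (map (algebraMap K L) B)).Finite ∧
    (∀ P : PlaneCurve.Plane L, Module.Finite L (PlaneCurve.localRing P ⧸
      PlaneCurve.localIdeal (map (algebraMap K L) A) (map (algebraMap K L) B) P)) ∧
    (∀ P : PlaneCurve.Plane L,
      0 < PlaneCurve.intersectionMultiplicity
          (map (algebraMap K L) A) (map (algebraMap K L) B) P ↔
        P ∈ PlaneCurve.commonPoints (map (algebraMap K L) A) (map (algebraMap K L) B)) ∧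
    ∑ᶠ P ∈ PlaneCurve.commonPoints (map (algebraMap K L) A) (map (algebraMap K L) B),
      PlaneCurve.intersectionMultiplicity
        (map (algebraMap K L) A) (map (algebraMap K L) B) P = m * n := by
  have hclosed : IsAlgClosed L := IsAlgClosure.isAlgClosed K
  have : Infinite L := IsAlgClosed.instInfinite
  have hA' : (map (algebraMap K L) A).IsHomogeneous m := hA.map _
  have hB' : (map (algebraMap K L) B).IsHomogeneous n := hB.map _
  have hrel := PlaneCurve.isRelPrime_of_forall_dvd_eq_C hAB
  have hreg := PlaneCurve.dvd_of_dvd_mul_map (L := L)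
    fun _ => hrel.dvd_of_dvd_mul_left
  -- Once the quotient is finite-dimensional, positive `finrank` means nontriviality, which
  -- characterizes the common points.
  suffices h : (PlaneCurve.commonPoints (map (algebraMap K L) A) (map (algebraMap K L) B)).Finite ∧
      (∀ P : PlaneCurve.Plane L, Module.Finite L (PlaneCurve.localRing P ⧸
        PlaneCurve.localIdeal (map (algebraMap K L) A) (map (algebraMap K L) B) P)) ∧
      ∑ᶠ P ∈ PlaneCurve.commonPoints (map (algebraMap K L) A) (map (algebraMap K L) B),
        PlaneCurve.intersectionMultiplicity
          (map (algebraMap K L) A) (map (algebraMap K L) B) P = m * n by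
    refine ⟨h.1, h.2.1, fun P => ?_, h.2.2⟩
    have := h.2.1 P
    rw [PlaneCurve.intersectionMultiplicity, Module.finrank_pos_iff,
      PlaneCurve.nontrivial_localQuotient_iff hA' hB']
  -- The zero polynomial is homogeneous of every degree, so `m` is then arbitrary; but `B` is a
  -- nonzero constant, whence `n = 0` and there are no common points.
  by_cases hA0 : A = 0
  · have hu : IsUnit B := hrel (by simp [hA0]) dvd_rfl
    have hn : n = 0 := by
      obtain ⟨c, hc⟩ := hAB B (by simp [hA0]) dvd_rfl
      exact hB.inj_right (hc ▸ isHomogeneous_C (Fin 3) c) hu.ne_zero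
    have hempty : PlaneCurve.commonPoints (map (algebraMap K L) A)
        (map (algebraMap K L) B) = ∅ := Set.eq_empty_of_forall_notMem fun P hP =>
      ((hu.map (map (algebraMap K L))).map (eval P.rep)).ne_zero hP.2
    exact ⟨hempty ▸ Set.finite_empty, fun P =>
      PlaneCurve.finite_localQuotient_of_notMem hA' hB' (hempty ▸ Set.notMem_empty P),
      by rw [hempty, finsum_mem_empty, hn, mul_zero]⟩
  · have hA0' : map (algebraMap K L) A ≠ 0 := by
      rwa [Ne, map_eq_zero_iff _ (map_injective _ (algebraMap K L).injective)]
    exact ⟨PlaneCurve.finite_commonPoints hA' hB' hA0' hreg,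
      PlaneCurve.finite_localQuotient hA' hB' hA0' hreg,
      PlaneCurve.finsum_intersectionMultiplicity hA' hB' hA0' hreg⟩
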